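/- Let $G$ be a countable amenable group with identity $1$, and let $X=\mathbb N^G$ be the full shift ($\mathbb N=\{0,1,2,\dots\}$) with its product topology and Borel $\sigma$-algebra $\mathcal B$, on which $G$ acts by $(g\cdot x)(h)=x(hg)$. Write $x_F$ for the restriction of $x$ to $F\subseteq G$, $X_F=\mathbb N^F$, $[w]=\{x\in X: x_F=w\}$ for $w\in X_F$, and $\mathcal B_{F^c}$ for the $\sigma$-algebra generated by the coordinates outside $F$; for $w\in X_F$ let $w\,x_{F^c}$ be the configuration equal to $w$ on $F$ and to $x$ off $F$. A nonempty finite set $F\subseteq G$ is $(K,\delta)$-invariant if $|KF\,\triangle\, F|<\delta|F|$, and $\lim_{F\to G}f(F)=L$ means that for every $\epsilon>0$ there are a nonempty finite $K\subseteq G$ and $\delta>0$ with $|f(F)-L|<\epsilon$ for every $(K,\delta)$-invariant $F$. Let $\{E_m\}_{m\ge 0}$ be an exhausting sequence, i.e. a strictly increasing sequence of finite sets with $E_0=\emptyset$, $E_1=\{1\}$ and $\bigcup_m E_m=G$. For $\phi:X\to\mathbb R$ and finite $F\subseteq G$ put $\phi_F(x)=\sum_{g\in F}\phi(g\cdot x)$,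 $\delta_F(\phi)=\sup\{|\phi(x)-\phi(y)|:x_F=y_F\}$ and $Z_F(\phi)=\sum_{w\in X_F}\exp(\sup\phi_F([w]))$. Suppose that $\phi$ is exp-summable, i.e. $Z_{\{1\}}(\phi)<\infty$, and has summable variation according to $\{E_m\}_m$, i.e. $\sum_{m\ge1}|E_{m+1}^{-1}\setminus E_m^{-1}|\,\delta_{E_m}(\phi)<\infty$. Let $\mu$ be a DLR measure for $\phi$, i.e. a Borel probability measure on $X$ such that, for every nonempty finite $K\subseteq G$ and every $B\in\mathcal B$, for $\mu$-almost every $x$, $$\mu(B\mid\mathcal B_{K^c})(x)=\lim_{m\to\infty}\frac{\sum_{w\in X_K}\exp(\phi_{E_m}(w\,x_{K^c}))\,\mathbf 1_{\{w\,x_{K^c}\in B\}}}{\sum_{v\in X_K}\exp(\phi_{E_m}(v\,x_{K^c}))}.$$ Then the pressure $p(\phi)=\lim_{F\to G}\frac1{|F|}\log Z_F(\phi)$ exists in $\mathbb R$, and for every $\epsilon>0$ there exist a nonempty finite $K\subseteq G$ and $\delta>0$ such that for every $(K,\delta)$-invariant nonempty finite set $F\subseteq G$, for $\mu$-almost every $x\in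 X$, it holds for every $y\in X$ that $$e^{-\epsilon|F|}\le\frac{\mu([y_F]\mid\mathcal B_{F^c})(x)}{\exp(\phi_F(y)-p(\phi)|F|)}\le e^{\epsilon|F|}.$$ In particular, $\mu$ is a Bowen–Gibbs measure for $\phi$ with constant $p(\phi)$: for every $\epsilon>0$ there exist a nonempty finite $K\subseteq G$ and $\delta>0$ such that for every $(K,\delta)$-invariant nonempty finite set $F\subseteq G$ and every $x\in X$, $$e^{-\epsilon|F|}\le\frac{\mu([x_F])}{\exp(\phi_F(x)-p(\phi)|F|)}\le e^{\epsilon|F|}.$$ -/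

import Mathlib

open scoped ENNReal Topology Pointwise symmDiff MeasureTheory ProbabilityTheory

noncomputable section

namespace GibbsFullShift

variable {G : Type*} [Group G] [DecidableEq G]

/-! The configuration space is the full shift `G → ℕ`, with the product (= Borel) σ-algebra.
Nonempty finite subsets of `G` are finsets `F : Finset G` with `F.Nonempty`. -/

/-- The translation action `(g · x)(h) = x (h g)`. -/
def shift (g : G) (x : G → ℕ) : G → ℕ := fun h => x (h * g)

/-- The cylinder set `[w]` of all configurations whose restriction to `F` is `w`. -/
def cyl (F : Finset G) (w : F → ℕ) : Set (G → ℕ) := {x | F.restrict x = w}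

/-- The configuration `w x_{Kᶜ}`, equal to `w` on `K` and to `x` off `K`. -/
def glue (K : Finset G) (w : K → ℕ) (x : G → ℕ) : G → ℕ :=
  fun g => if h : g ∈ K then w ⟨g, h⟩ else x g

/-- `F` is `(K, δ)`-invariant: `|KF ∆ F| < δ |F|`. -/
def IsInvariant (K : Finset G) (δ : ℝ) (F : Finset G) : Prop :=
  (((K * F) ∆ F).card : ℝ) < δ * F.card

variable (G) in
/-- Amenability: for all `K` and `δ > 0` there is a `(K, δ)`-invariant set. -/
def IsAmenable : Prop :=
  ∀ K : Finset G, K.Nonempty → ∀ δ : ℝ, 0 < δ →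
    ∃ F : Finset G, F.Nonempty ∧ IsInvariant K δ F

/-- `f F` converges to `L` as `F` becomes more and more invariant. -/
def TendsToInvariant (f : Finset G → ℝ) (L : ℝ) : Prop :=
  ∀ ε : ℝ, 0 < ε → ∃ K : Finset G, K.Nonempty ∧ ∃ δ : ℝ, 0 < δ ∧
    ∀ F : Finset G, F.Nonempty → IsInvariant K δ F → |f F - L| < ε

/-- Exhausting sequences `∅ = E₀ ⊂ E₁ = {1} ⊂ E₂ ⊂ …` of finite sets with union `G`. -/
structure IsExhaustion (E : ℕ → Finset G) : Prop where
  zero : E 0 = ∅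
  one : E 1 = {1}
  strictMono : StrictMono E
  exhausts : ∀ g : G, ∃ m, g ∈ E m

/-- The variation `δ_E(φ) = sup {|φ x - φ y| : x_E = y_E}`, with values in `[0, ∞]`. -/
def variation (φ : (G → ℕ) → ℝ) (E : Finset G) : ℝ≥0∞ :=
  ⨆ (x : G → ℕ) (y : G → ℕ) (_ : ∀ g ∈ E, x g = y g), ENNReal.ofReal |φ x - φ y|

/-- The `F`-sum of variations `V_F(φ) = ∑_{m ≥ 1} |E_{m+1}⁻¹ F \ E_m⁻¹ F| δ_{E_m}(φ)`. -/
def sumVariations (E : ℕ → Finset G) (φ : (G → ℕ) → ℝ) (F : Finset G) : ℝ≥0∞ :=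
  ∑' m : ℕ, ((((E (m + 2))⁻¹ * F) \ ((E (m + 1))⁻¹ * F)).card : ℝ≥0∞) * variation φ (E (m + 1))

/-- Summable variation according to `E`: `V(φ) = V_{{1}}(φ) < ∞`. -/
def HasSummableVariation (E : ℕ → Finset G) (φ : (G → ℕ) → ℝ) : Prop :=
  sumVariations E φ {1} < ∞

/-- `φ_F(x) = ∑_{g ∈ F} φ(g · x)`. -/
def birkhoff (φ : (G → ℕ) → ℝ) (F : Finset G) (x : G → ℕ) : ℝ :=
  ∑ g ∈ F, φ (shift g x)

/-- The partition function `Z_F(φ) = ∑_{w} exp (sup φ_F([w]))`, with values in `[0, ∞]`. -/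
def partitionFunction (φ : (G → ℕ) → ℝ) (F : Finset G) : ℝ≥0∞ :=
  ∑' w : F → ℕ, EReal.exp (⨆ x ∈ cyl F w, (birkhoff φ F x : EReal))

/-- `φ` is exp-summable: `Z_{{1}}(φ) < ∞`. -/
def IsExpSummable (φ : (G → ℕ) → ℝ) : Prop :=
  partitionFunction φ {1} < ∞

/-- `p` is the limit of `(1 / |F|) log Z_F(φ)` as `F` becomes more and more invariant. -/
def HasPressure (φ : (G → ℕ) → ℝ) (p : ℝ) : Prop :=
  TendsToInvariant (fun F => Real.log (partitionFunction φ F).toReal / F.card) p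

/-- The pressure `p(φ)`, that is, the `p` with `HasPressure φ p` (arbitrary if there is none). -/
def pressure (φ : (G → ℕ) → ℝ) : ℝ := Classical.epsilon (HasPressure φ)

/-- The Gibbsian specification
`γ_K(B, x) = lim_m (∑_w exp (φ_{E_m}(w x_{Kᶜ})) 1_{w x_{Kᶜ} ∈ B}) / ∑_v exp (φ_{E_m}(v x_{Kᶜ}))`. -/
def gibbsSpec (E : ℕ → Finset G) (φ : (G → ℕ) → ℝ) (K : Finset G) (B : Set (G → ℕ))
    (x : G → ℕ) : ℝ :=
  Filter.limUnder Filter.atTop fun m : ℕ =>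
    (∑' w : K → ℕ, B.indicator (fun z => Real.exp (birkhoff φ (E m) z)) (glue K w x)) /
      ∑' v : K → ℕ, Real.exp (birkhoff φ (E m) (glue K v x))

/-- The σ-algebra `𝓑_{Kᶜ}` generated by the coordinates outside `K`. -/
abbrev outside (K : Finset G) : MeasurableSpace (G → ℕ) :=
  MeasureTheory.cylinderEvents (X := fun _ : G => ℕ) ((K : Set G)ᶜ)

/-- `μ` is a DLR measure for `φ`: `μ(B | 𝓑_{Kᶜ}) = γ_K(B, ·)` almost surely, for all nonempty
finite `K` and all measurable `B`. -/
def IsDLR (E : ℕ → Finset G) (φ : (G → ℕ) → ℝ) (μ : MeasureTheory.Measure (G → ℕ)) : Prop :=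
  ∀ K : Finset G, K.Nonempty → ∀ B : Set (G → ℕ), MeasurableSet B →
    μ⟦B | outside K⟧ =ᵐ[μ] gibbsSpec E φ K B

/-- `μ` is a Bowen–Gibbs measure for `φ` with constant `p`. -/
def IsBowenGibbsWith (φ : (G → ℕ) → ℝ) (p : ℝ) (μ : MeasureTheory.Measure (G → ℕ)) : Prop :=
  ∀ ε : ℝ, 0 < ε → ∃ K : Finset G, K.Nonempty ∧ ∃ δ : ℝ, 0 < δ ∧
    ∀ F : Finset G, F.Nonempty → IsInvariant K δ F → ∀ x : G → ℕ,
      Real.exp (-ε * F.card) ≤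
          μ.real (cyl F (F.restrict x)) / Real.exp (birkhoff φ F x - p * F.card) ∧
        μ.real (cyl F (F.restrict x)) / Real.exp (birkhoff φ F x - p * F.card) ≤
          Real.exp (ε * F.card)

end GibbsFullShift

end

noncomputable section

namespace GibbsFullShift

open Filter MeasureTheory

/-! ### Cylinder sets, exhaustions and weights -/

section Basic

variable {G : Type*}

/-! Given the outside configuration, a DLR measure weights $w\in X_F$ by the limit of
$\exp\phi_{E_m}(w\,x_{F^c})$, suitably normalized. Differences of $\phi_{E_m}$ between
configurations equal off $F$ are those of $\phi_F$ up to the exterior variation $V_F$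
(`abs_birkhoff_sub_sub_le`), while $\phi_F$ oscillates by at most some $D$ on each cylinder over
$F$. Hence the conditional probability of $[y_F]$ is $\exp(\phi_F(y)\pm(V_F+2D))/Z_F$
(`gibbsSpec_cyl_bounds`). Summable variation makes both $V_F$ and $D$ of order $o(|F|)$.

It remains that $\log Z_F=p|F|+o(|F|)$. Finner's inequality (`cylSum_prod_rpow_le`) gives Shearer's
inequality for $\log Z_F$. Covering $F$ by translates of a nearly optimal $T$ then yields the limit
per site (`SatisfiesShearer.exists_tendsTo`), without tilings. The bounds for $\mu$ itself follow by
integrating the conditional ones. -/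

theorem mem_cyl_restrict {F : Finset G} {x y : G → ℕ} :
    x ∈ cyl F (F.restrict y) ↔ ∀ g ∈ F, x g = y g := by
  simp [cyl, funext_iff]

theorem le_variation (φ : (G → ℕ) → ℝ) {K : Finset G} {x y : G → ℕ} (h : ∀ g ∈ K, x g = y g) :
    ENNReal.ofReal |φ x - φ y| ≤ variation φ K :=
  le_iSup_of_le x (le_iSup₂_of_le y h le_rfl)

theorem measurableSet_cyl (F : Finset G) (w : F → ℕ) : MeasurableSet (cyl F w) :=
  Finset.measurable_restrict (X := fun _ : G => ℕ) F (measurableSet_singleton w)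

variable [Group G]

theorem IsExhaustion.one_mem {E : ℕ → Finset G} (hE : IsExhaustion E) (m : ℕ) :
    1 ∈ E (m + 1) :=
  hE.strictMono.monotone (Nat.succ_le_succ (Nat.zero_le m)) (by simp [hE.one])

theorem IsExhaustion.tendsto_atTop {E : ℕ → Finset G} (hE : IsExhaustion E) :
    Tendsto E atTop atTop :=
  tendsto_atTop_finset_of_monotone hE.strictMono.monotone hE.exhausts

theorem shift_shift (f g : G) (x : G → ℕ) : shift f (shift g x) = shift (f * g) x := by
  ext h
  simp [shift, mul_assoc]

/-- The weight `sup exp (φ_F([y_F]))` of the restriction of `y` to `F`. -/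
def supWeight (φ : (G → ℕ) → ℝ) (F : Finset G) (y : G → ℕ) : ℝ≥0∞ :=
  ⨆ z ∈ cyl F (F.restrict y), ENNReal.ofReal (Real.exp (birkhoff φ F z))

theorem dependsOn_supWeight (φ : (G → ℕ) → ℝ) (F : Finset G) :
    DependsOn (supWeight φ F) (F : Set G) := by
  intro y z h
  have : F.restrict y = F.restrict z := funext fun i => h i.1 i.2
  rw [supWeight, supWeight, this]

theorem exp_iSup_birkhoff (φ : (G → ℕ) → ℝ) (F : Finset G) (w : F → ℕ) :
    EReal.exp (⨆ x ∈ cyl F w, (birkhoff φ F x : EReal)) =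
      ⨆ x ∈ cyl F w, ENNReal.ofReal (Real.exp (birkhoff φ F x)) := by
  rw [← EReal.expOrderIso_apply]
  simp only [OrderIso.map_iSup, EReal.expOrderIso_apply, EReal.exp_coe]

theorem le_supWeight (φ : (G → ℕ) → ℝ) (F : Finset G) {y z : G → ℕ} (h : ∀ g ∈ F, z g = y g) :
    ENNReal.ofReal (Real.exp (birkhoff φ F z)) ≤ supWeight φ F y :=
  le_iSup₂_of_le z (mem_cyl_restrict.2 h) le_rfl

/-- Here $F'=Fg$, described by membership so that no decidable equality is needed. The shift by $g$
is onto and matches cylinders over $F'$ with cylinders over $F$, so the two sums agree term by term.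
-/
theorem partitionFunction_eq_of_translate (φ : (G → ℕ) → ℝ) {F F' : Finset G} {g : G}
    (hmem : ∀ f ∈ F, f * g ∈ F') (hmem' : ∀ f ∈ F', f * g⁻¹ ∈ F)
    (hbirk : ∀ x, birkhoff φ F (shift g x) = birkhoff φ F' x) :
    partitionFunction φ F' = partitionFunction φ F := by
  let e₀ : F ≃ F' :=
    { toFun := fun i => ⟨i * g, hmem i i.2⟩
      invFun := fun i => ⟨i * g⁻¹, hmem' i i.2⟩
      left_inv := fun i => Subtype.ext (mul_inv_cancel_right (i : G) g)
      right_inv := fun i => Subtype.ext (inv_mul_cancel_right (i : G) g) }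
  have hsurj : Function.Surjective (shift (G := G) g) := fun x => ⟨shift g⁻¹ x, by
    rw [shift_shift]; ext h; simp [shift]⟩
  refine ((e₀.arrowCongr (Equiv.refl ℕ)).tsum_eq _).symm.trans (tsum_congr fun w => ?_)
  rw [exp_iSup_birkhoff, exp_iSup_birkhoff]
  have hcyl : ∀ x, shift g x ∈ cyl F w ↔ x ∈ cyl F' (e₀.arrowCongr (Equiv.refl ℕ) w) := by
    intro x
    rw [cyl, cyl, Set.mem_ofPred_eq, Set.mem_ofPred_eq, ← Equiv.symm_apply_eq]
    rfl
  rw [← hsurj.iSup_comp (g := fun z => ⨆ _ : z ∈ cyl F w,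
    ENNReal.ofReal (Real.exp (birkhoff φ F z)))]
  simp only [hcyl, hbirk]

end Basic

section Coordinates

variable {G : Type*} [DecidableEq G]

/-! ### Sums over the configurations on a finite set -/

theorem restrict_glue (F : Finset G) (w : F → ℕ) (x : G → ℕ) : F.restrict (glue F w x) = w := by
  ext i
  simp [glue]

theorem glue_of_mem {F : Finset G} (w : F → ℕ) (x : G → ℕ) {g : G} (hg : g ∈ F) :
    glue F w x g = w ⟨g, hg⟩ := by
  simp [glue, hg]

theorem glue_of_notMem {F : Finset G} (w : F → ℕ) (x : G → ℕ) {g : G} (hg : g ∉ F) :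
    glue F w x g = x g := by
  simp [glue, hg]

/-- The sum of `f` over all modifications of `x` on `F`. -/
def cylSum (F : Finset G) (f : (G → ℕ) → ℝ≥0∞) (x : G → ℕ) : ℝ≥0∞ :=
  ∑' w : F → ℕ, f (glue F w x)

theorem cylSum_empty (f : (G → ℕ) → ℝ≥0∞) (x : G → ℕ) : cylSum ∅ f x = f x := by
  rw [cylSum, tsum_eq_single (default : (∅ : Finset G) → ℕ)
    (fun w hw => absurd (Subsingleton.elim w _) hw)]
  congr 1

/-- A configuration on `insert a F` is a configuration on `F` and a symbol at `a`. -/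
def insertEquiv {F : Finset G} {a : G} (ha : a ∉ F) :
    (↥(insert a F) → ℕ) ≃ (F → ℕ) × ℕ where
  toFun w := (fun i => w ⟨i, Finset.mem_insert_of_mem i.2⟩, w ⟨a, Finset.mem_insert_self a F⟩)
  invFun p i := if h : i.1 ∈ F then p.1 ⟨i, h⟩ else p.2
  left_inv w := by
    ext ⟨i, hi⟩
    by_cases h : i ∈ F
    · simp [h]
    · obtain rfl : i = a := (Finset.mem_insert.1 hi).resolve_right h
      simp [h]
  right_inv p := by
    ext <;> simp [ha]

theorem cylSum_insert {F : Finset G} {a : G} (ha : a ∉ F) (f : (G → ℕ) → ℝ≥0∞) (x : G → ℕ) :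
    cylSum (insert a F) f x = cylSum F (fun y => ∑' c : ℕ, f (Function.update y a c)) x := by
  rw [cylSum, ← (insertEquiv ha).symm.tsum_eq]
  refine (ENNReal.tsum_prod (f := fun w c =>
    f (glue (insert a F) ((insertEquiv ha).symm (w, c)) x))).trans ?_
  refine tsum_congr fun w => tsum_congr fun c => ?_
  congr 1
  ext g
  by_cases hg : g = a
  · subst hg
    simp [glue, insertEquiv, ha]
  · by_cases hF : g ∈ F <;> simp [glue, insertEquiv, hg, hF]

/-- Hölder's inequality for the counting measure on $\mathbb N$. -/
theorem tsum_prod_rpow_le {ι : Type*} (s : Finset ι) (f : ι → ℕ → ℝ≥0∞) {p : ι → ℝ}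
    (hp : ∑ i ∈ s, p i = 1) (h2p : ∀ i ∈ s, 0 ≤ p i) :
    ∑' c, ∏ i ∈ s, f i c ^ p i ≤ ∏ i ∈ s, (∑' c, f i c) ^ p i := by
  simpa [MeasureTheory.lintegral_count] using ENNReal.lintegral_prod_norm_pow_le
    (μ := MeasureTheory.Measure.count) s (f := f)
    (fun i _ => (measurable_of_countable (f i)).aemeasurable) hp h2p

/-- Finner's inequality: the generalized Hölder inequality for functions of overlapping groups of
coordinates. -/
theorem cylSum_prod_rpow_le {ι : Type*} (F : Finset G) (I : Finset ι) (S : ι → Finset G) {k : ℕ}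
    (hk : 0 < k) (hcount : ∀ a ∈ F, (I.filter fun i => a ∈ S i).card = k)
    (f : ι → (G → ℕ) → ℝ≥0∞) (hf : ∀ i, DependsOn (f i) (S i : Set G)) (x : G → ℕ) :
    cylSum F (fun y => ∏ i ∈ I, f i y ^ (k : ℝ)⁻¹) x ≤
      ∏ i ∈ I, cylSum (F ∩ S i) (f i) x ^ (k : ℝ)⁻¹ := by
  induction F using Finset.induction_on generalizing f with
  | empty => simp [cylSum_empty]
  | insert a F ha ih =>
    -- Induction on the coordinates: the coordinate `a` is summed out of each factor that sees it.
    -- Exactly `k` factors do, so Hölder applies to them with weights $1/k$; the others are constant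
    -- in `a`.
    set f' : ι → (G → ℕ) → ℝ≥0∞ := fun i => if a ∈ S i then
      (fun y => ∑' c : ℕ, f i (Function.update y a c)) else f i with hf'def
    have hf' : ∀ i, DependsOn (f' i) (S i : Set G) := by
      intro i
      by_cases hi : a ∈ S i
      · simp only [hf'def, hi, if_true]
        intro y z hyz
        refine tsum_congr fun c => hf i fun g hg => ?_
        by_cases hga : g = a
        · simp [hga]
        · simp [hga, hyz g hg]
      · simpa only [hf'def, hi, if_false] using hf i
    have hstep : ∀ y, ∑' c : ℕ, ∏ i ∈ I, f i (Function.update y a c) ^ (k : ℝ)⁻¹ ≤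
        ∏ i ∈ I, f' i y ^ (k : ℝ)⁻¹ := by
      intro y
      have hnot : ∀ i ∈ I.filter (fun i => ¬ a ∈ S i), ∀ c,
          f i (Function.update y a c) ^ (k : ℝ)⁻¹ = f' i y ^ (k : ℝ)⁻¹ := by
        intro i hi c
        have hi := (Finset.mem_filter.1 hi).2
        simp only [hf'def, hi, if_false]
        congr 1
        refine hf i fun g hg => Function.update_of_ne ?_ _ _
        rintro rfl
        exact hi hg
      calc ∑' c : ℕ, ∏ i ∈ I, f i (Function.update y a c) ^ (k : ℝ)⁻¹
          = ∑' c : ℕ, (∏ i ∈ I with a ∈ S i, f i (Function.update y a c) ^ (k : ℝ)⁻¹) *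
              ∏ i ∈ I with ¬ a ∈ S i, f' i y ^ (k : ℝ)⁻¹ := by
            refine tsum_congr fun c => ?_
            rw [← Finset.prod_filter_mul_prod_filter_not I (fun i => a ∈ S i)]
            congr 1
            exact Finset.prod_congr rfl fun i hi => hnot i hi c
        _ = (∑' c : ℕ, ∏ i ∈ I with a ∈ S i, f i (Function.update y a c) ^ (k : ℝ)⁻¹) *
              ∏ i ∈ I with ¬ a ∈ S i, f' i y ^ (k : ℝ)⁻¹ := ENNReal.tsum_mul_right
        _ ≤ (∏ i ∈ I with a ∈ S i, f' i y ^ (k : ℝ)⁻¹) *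
              ∏ i ∈ I with ¬ a ∈ S i, f' i y ^ (k : ℝ)⁻¹ := by
            gcongr
            refine (tsum_prod_rpow_le _ _ ?_ fun _ _ => by positivity).trans (le_of_eq ?_)
            · rw [Finset.sum_const, hcount a (Finset.mem_insert_self a F), nsmul_eq_mul]
              field_simp
            · refine Finset.prod_congr rfl fun i hi => ?_
              have hi := (Finset.mem_filter.1 hi).2
              simp only [hf'def, hi, if_true]
        _ = _ := Finset.prod_filter_mul_prod_filter_not I (fun i => a ∈ S i) _
    rw [cylSum_insert ha]
    refine (ENNReal.tsum_le_tsum fun w => hstep _).trans ?_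
    refine (ih (fun b hb => hcount b (Finset.mem_insert_of_mem hb)) f' hf').trans (le_of_eq ?_)
    refine Finset.prod_congr rfl fun i _ => ?_
    congr 1
    by_cases hi : a ∈ S i
    · rw [Finset.insert_inter_of_mem hi,
        cylSum_insert (fun h => ha (Finset.mem_inter.1 h).1)]
      simp only [hf'def, hi, if_true]
    · rw [Finset.insert_inter_of_notMem hi]
      simp only [hf'def, hi, if_false]

end Coordinates

variable {G : Type*} [Group G] [DecidableEq G]

/-! ### Invariant sets -/

/-- Enlarging $K$ enlarges $KF\setminus F$ but shrinks $F\setminus KF$. The latter is controlled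
through a single $k\in K$: $|F\setminus KF|\le|F\setminus kF|=|kF\setminus F|\le|KF\setminus F|$,
whence the factor 2. -/
theorem IsInvariant.mono {K K' F : Finset G} {δ δ' : ℝ} (hK : K.Nonempty) (hKK' : K ⊆ K')
    (hδ : 2 * δ' ≤ δ) (h : IsInvariant K' δ' F) : IsInvariant K δ F := by
  obtain ⟨k, hk⟩ := hK
  have h1 : ((K * F) \ F).card ≤ ((K' * F) ∆ F).card :=
    Finset.card_le_card ((Finset.sdiff_subset_sdiff (Finset.mul_subset_mul_right hKK')
      subset_rfl).trans le_sup_left)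
  have h2 : (F \ (K * F)).card ≤ ((K' * F) ∆ F).card := by
    have hcard : (k • F).card = F.card := Finset.card_smul_finset k F
    have hsub : k • F ⊆ K * F := Finset.smul_finset_subset_mul hk
    calc (F \ (K * F)).card ≤ (F \ (k • F)).card :=
          Finset.card_le_card (Finset.sdiff_subset_sdiff subset_rfl hsub)
      _ = ((k • F) \ F).card := (Finset.card_sdiff_comm hcard).symm
      _ ≤ ((K * F) \ F).card :=
          Finset.card_le_card (Finset.sdiff_subset_sdiff hsub subset_rfl)
      _ ≤ _ := h1
  have h3 : ((K * F) ∆ F).card ≤ ((K * F) \ F).card + (F \ (K * F)).card := by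
    rw [symmDiff_def]; exact Finset.card_union_le _ _
  have h4 : (((K * F) ∆ F).card : ℝ) ≤ 2 * ((K' * F) ∆ F).card := by
    exact_mod_cast (by omega : ((K * F) ∆ F).card ≤ 2 * ((K' * F) ∆ F).card)
  unfold IsInvariant at *
  have : (0 : ℝ) ≤ F.card := by positivity
  nlinarith

variable (G) in
/-- The filter of sets that are more and more invariant. -/
def invariantFilter : Filter (Finset G) where
  sets := {s | ∃ K : Finset G, K.Nonempty ∧ ∃ δ : ℝ, 0 < δ ∧
    ∀ F : Finset G, F.Nonempty → IsInvariant K δ F → F ∈ s}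
  univ_sets := ⟨{1}, by simp, 1, one_pos, by simp⟩
  sets_of_superset := by
    rintro s t ⟨K, hK, δ, hδ, h⟩ hst
    exact ⟨K, hK, δ, hδ, fun F hF hi => hst (h F hF hi)⟩
  inter_sets := by
    rintro s t ⟨K, hK, δ, hδ, h⟩ ⟨K', hK', δ', hδ', h'⟩
    refine ⟨K ∪ K', hK.mono Finset.subset_union_left, min δ δ' / 2, by positivity,
      fun F hF hi => ⟨h F hF (hi.mono hK Finset.subset_union_left ?_),
        h' F hF (hi.mono hK' Finset.subset_union_right ?_)⟩⟩
    · linarith [min_le_left δ δ']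
    · linarith [min_le_right δ δ']

theorem eventually_invariantFilter {P : Finset G → Prop} :
    (∀ᶠ F in invariantFilter G, P F) ↔ ∃ K : Finset G, K.Nonempty ∧ ∃ δ : ℝ, 0 < δ ∧
      ∀ F : Finset G, F.Nonempty → IsInvariant K δ F → P F := Iff.rfl

theorem eventually_nonempty : ∀ᶠ F in invariantFilter G, F.Nonempty :=
  eventually_invariantFilter.2 ⟨{1}, by simp, 1, one_pos, fun _ hF _ => hF⟩

theorem eventually_card_sdiff_le (K : Finset G) {ε : ℝ} (hε : 0 < ε) :
    ∀ᶠ F in invariantFilter G, (((K * F) \ F).card : ℝ) ≤ ε * F.card := by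
  -- Adding 1 only ensures nonemptiness, as `K` may be empty.
  refine eventually_invariantFilter.2 ⟨insert 1 K, by simp, ε, hε, fun F _ hi => ?_⟩
  refine le_trans ?_ (le_of_lt hi)
  exact_mod_cast Finset.card_le_card ((Finset.sdiff_subset_sdiff
    (Finset.mul_subset_mul_right (Finset.subset_insert _ _)) subset_rfl).trans le_sup_left)

/-- Since $sg=(st^{-1})(tg)$, the injection $g\mapsto sg$ lands in $KF\setminus F$. This counts the
translates that straddle the boundary of $F$. -/
theorem card_filter_mem_notMem_le (A F K : Finset G) {s t : G} (hst : s * t⁻¹ ∈ K) :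
    (A.filter fun g => t * g ∈ F ∧ s * g ∉ F).card ≤ ((K * F) \ F).card := by
  refine Finset.card_le_card_of_injOn (fun g => s * g) (fun g hg => ?_)
    (fun a _ b _ hab => mul_left_cancel hab)
  simp only [Finset.coe_filter, Set.mem_ofPred_eq] at hg
  simp only [Finset.coe_sdiff, Set.mem_sdiff, Finset.mem_coe]
  refine ⟨?_, hg.2.2⟩
  have := Finset.mul_mem_mul hst hg.2.1
  rwa [show s * t⁻¹ * (t * g) = s * g by group] at this

/-! ### The infimum rule -/

/-- Shearer's inequality for a real function of finite sets. -/
def SatisfiesShearer (h : Finset G → ℝ) : Prop :=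
  ∀ (F I : Finset G) (S : G → Finset G) (k : ℕ), 0 < k → (∀ i ∈ I, S i ⊆ F) →
    (∀ a ∈ F, (I.filter fun i => a ∈ S i).card = k) → k * h F ≤ ∑ i ∈ I, h (S i)

theorem SatisfiesShearer.le_card_mul {h : Finset G → ℝ} (hsh : SatisfiesShearer h)
    (hinv : ∀ F g, h (F * {g}) = h F) (F : Finset G) : h F ≤ F.card * h {1} := by
  have h1 := hsh F F (fun a => {a}) 1 one_pos (by simp) (fun a ha => by
    rw [Finset.card_eq_one]
    exact ⟨a, by ext; simp; constructor <;> grind⟩)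
  have h2 : ∀ a, h {a} = h {1} := fun a => by simpa using hinv {1} a
  simpa [h2] using h1

/-- The sets $Tg\cap F$ with $g\in T^{-1}F$ cover each point of $F$ exactly $|T|$ times. At most
$|F|$ translates lie inside $F$, each contributing $h(T)$. The others straddle the boundary: there
are at most $|T|^2\,|TT^{-1}F\setminus F|$ of them, each costing at most $|T|\,h(\{1\})$. -/
theorem SatisfiesShearer.le_of_translates {h : Finset G → ℝ} (hsh : SatisfiesShearer h)
    (hinv : ∀ F g, h (F * {g}) = h F) (hnonneg : ∀ F, 0 ≤ h F) {T : Finset G}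
    (hT : T.Nonempty) (F : Finset G) :
    T.card * h F ≤ F.card * h T +
      T.card ^ 3 * ((((T * T⁻¹) * F) \ F).card * h {1}) := by
  set S : G → Finset G := fun g => (T * {g}) ∩ F with hS
  set I : Finset G := T⁻¹ * F with hI
  have hmem : ∀ g a, a ∈ S g ↔ (∃ t ∈ T, t * g = a) ∧ a ∈ F := fun g a => by
    simp [hS, Finset.mem_mul]
  have hcount : ∀ a ∈ F, (I.filter fun g => a ∈ S g).card = T.card := by
    intro a ha
    have : (I.filter fun g => a ∈ S g) = T⁻¹ * {a} := by
      ext g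
      simp only [Finset.mem_filter, hmem, hI, Finset.mem_mul, Finset.mem_inv, Finset.mem_singleton]
      constructor
      · rintro ⟨-, ⟨t, ht, rfl⟩, -⟩
        exact ⟨t⁻¹, ⟨t, ht, rfl⟩, _, rfl, by group⟩
      · rintro ⟨_, ⟨t, ht, rfl⟩, _, rfl, rfl⟩
        exact ⟨⟨_, ⟨t, ht, rfl⟩, _, ha, rfl⟩, ⟨t, ht, by group⟩, ha⟩
    rw [this, Finset.card_mul_singleton, Finset.card_inv]
  have key := hsh F I S T.card hT.card_pos (fun _ _ => Finset.inter_subset_right) hcount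
  rw [← Finset.sum_filter_add_sum_filter_not I (fun g => ∀ t ∈ T, t * g ∈ F)] at key
  have hgood : ∑ g ∈ I with ∀ t ∈ T, t * g ∈ F, h (S g) ≤ F.card * h T := by
    have e : ∀ g ∈ I.filter (fun g => ∀ t ∈ T, t * g ∈ F), h (S g) = h T := by
      intro g hg
      rw [← hinv T g]
      congr 1
      refine Finset.inter_eq_left.2 fun a ha => ?_
      obtain ⟨t, ht, b, hb, rfl⟩ := Finset.mem_mul.1 ha
      rw [Finset.mem_singleton.1 hb]
      have hg' := (Finset.mem_filter.1 hg).2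
      exact hg' t ht
    rw [Finset.sum_congr rfl e, Finset.sum_const, nsmul_eq_mul]
    refine mul_le_mul_of_nonneg_right ?_ (hnonneg T)
    obtain ⟨t, ht⟩ := hT
    exact_mod_cast Finset.card_le_card_of_injOn (fun g => t * g)
      (fun g hg => by
        have hg' := (Finset.mem_filter.1 hg).2
        exact hg' t ht) (fun a _ b _ hab => mul_left_cancel hab)
  have hbad : ∑ g ∈ I with ¬ ∀ t ∈ T, t * g ∈ F, h (S g) ≤
      T.card ^ 3 * ((((T * T⁻¹) * F) \ F).card * h {1}) := by
    have e : ∀ g ∈ I.filter (fun g => ¬ ∀ t ∈ T, t * g ∈ F), h (S g) ≤ T.card * h {1} := by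
      intro g _
      refine (hsh.le_card_mul hinv _).trans (mul_le_mul_of_nonneg_right ?_ (hnonneg _))
      exact_mod_cast (Finset.card_le_card Finset.inter_subset_left).trans
        (Finset.card_mul_singleton T g).le
    have hc : (I.filter (fun g => ¬ ∀ t ∈ T, t * g ∈ F)).card ≤
        T.card ^ 2 * (((T * T⁻¹) * F) \ F).card := by
      have hsub : I.filter (fun g => ¬ ∀ t ∈ T, t * g ∈ F) ⊆ (T ×ˢ T).biUnion
          fun q => I.filter fun g => q.1 * g ∈ F ∧ q.2 * g ∉ F := by
        intro g hg
        obtain ⟨hgI, hg⟩ := Finset.mem_filter.1 hg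
        push Not at hg
        obtain ⟨s, hs, hsg⟩ := hg
        obtain ⟨t, ht, f, hf, rfl⟩ := Finset.mem_mul.1 hgI
        refine Finset.mem_biUnion.2 ⟨(t⁻¹, s), Finset.mem_product.2
          ⟨by simpa using ht, hs⟩, Finset.mem_filter.2 ⟨hgI, ?_, hsg⟩⟩
        simpa using hf
      refine (Finset.card_le_card hsub).trans (Finset.card_biUnion_le.trans ?_)
      refine (Finset.sum_le_card_nsmul _ _ ((T * T⁻¹ * F) \ F).card fun q hq => ?_).trans ?_
      · rw [Finset.mem_product] at hq
        exact card_filter_mem_notMem_le I F _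
          (Finset.mul_mem_mul hq.2 (Finset.inv_mem_inv hq.1))
      · rw [Finset.card_product, smul_eq_mul, sq]
    have hc' : ((I.filter (fun g => ¬ ∀ t ∈ T, t * g ∈ F)).card : ℝ) ≤
        T.card ^ 2 * (((T * T⁻¹) * F) \ F).card := by exact_mod_cast hc
    refine (Finset.sum_le_card_nsmul _ _ _ e).trans ?_
    rw [nsmul_eq_mul]
    calc _ ≤ (T.card ^ 2 * (((T * T⁻¹) * F) \ F).card : ℝ) * (T.card * h {1}) :=
          mul_le_mul_of_nonneg_right hc' (mul_nonneg (by positivity) (hnonneg _))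
      _ = _ := by ring
  linarith

theorem SatisfiesShearer.exists_tendsTo_of_nonneg {h : Finset G → ℝ} (hsh : SatisfiesShearer h)
    (hinv : ∀ F g, h (F * {g}) = h F) (hnonneg : ∀ F, 0 ≤ h F) :
    ∃ L, TendsToInvariant (fun F => h F / F.card) L := by
  set R : Set ℝ := (fun F : Finset G => h F / F.card) '' {F | F.Nonempty}
  have hR : R.Nonempty := ⟨_, {1}, by simp, rfl⟩
  have hbdd : BddBelow R := ⟨0, by
    rintro _ ⟨F, -, rfl⟩; exact div_nonneg (hnonneg F) (by positivity)⟩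
  refine ⟨sInf R, fun ε hε => ?_⟩
  obtain ⟨_, ⟨T, hT, rfl⟩, hTlt⟩ := exists_lt_of_csInf_lt hR
    (show sInf R < sInf R + ε / 2 by linarith)
  have hc := hnonneg {1}
  have hk : (0 : ℝ) < T.card := by exact_mod_cast hT.card_pos
  -- After division by $|T||F|$ the boundary term is at most $|T|^2\eta\,h(\{1\})$. The `+ 1` in the
  -- witness covers $h(\{1\})=0$.
  obtain ⟨η, hη, hηc⟩ : ∃ η : ℝ, 0 < η ∧ (T.card : ℝ) ^ 2 * (η * h {1}) < ε / 2 := by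
    refine ⟨ε / (2 * (T.card ^ 2 * (h {1} + 1))), by positivity, ?_⟩
    rw [show (T.card : ℝ) ^ 2 * (ε / (2 * (T.card ^ 2 * (h {1} + 1))) * h {1}) =
      ε / 2 * (h {1} / (h {1} + 1)) by field_simp]
    have : h {1} / (h {1} + 1) < 1 := by rw [div_lt_one (by linarith)]; linarith
    nlinarith
  refine eventually_invariantFilter.1 ?_
  filter_upwards [eventually_card_sdiff_le (T * T⁻¹) hη, eventually_nonempty] with F hF hne
  have hF0 : (0 : ℝ) < F.card := by exact_mod_cast hne.card_pos
  have h1 := hsh.le_of_translates hinv hnonneg hT F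
  have h2 : sInf R ≤ h F / F.card := csInf_le hbdd ⟨F, hne, rfl⟩
  have h3 : h F / F.card ≤ h T / T.card + T.card ^ 2 * (η * h {1}) := by
    rw [div_le_iff₀ hF0]
    have h4 : T.card * h F ≤ F.card * h T + T.card ^ 3 * (η * F.card * h {1}) := by
      refine h1.trans ?_
      gcongr
    have h5 : T.card * ((h T / T.card + T.card ^ 2 * (η * h {1})) * F.card) =
        F.card * h T + T.card ^ 3 * (η * F.card * h {1}) := by
      field_simp
    exact le_of_mul_le_mul_left (h5 ▸ h4) hk
  rw [abs_lt]
  constructor <;> linarith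

/-- The infimum rule: a translation invariant function of finite sets that satisfies Shearer's
inequality and grows at least linearly has a limit per site. -/
theorem SatisfiesShearer.exists_tendsTo {h : Finset G → ℝ} (hsh : SatisfiesShearer h)
    (hinv : ∀ F g, h (F * {g}) = h F) {c : ℝ} (hc : ∀ F : Finset G, F.card * c ≤ h F) :
    ∃ L, TendsToInvariant (fun F => h F / F.card) L := by
  -- Subtracting a multiple of the cardinality preserves Shearer's inequality, since double counting
  -- gives $\sum_i|S_i|=k|F|$.
  have hsh' : SatisfiesShearer fun F => h F - F.card * c := by
    intro F I S k hk hS hcount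
    have h1 := hsh F I S k hk hS hcount
    have h2 : ∑ i ∈ I, (S i).card = F.card * k := by
      have := Finset.sum_card_bipartiteAbove_eq_sum_card_bipartiteBelow
        (s := I) (t := F) (fun i a => a ∈ S i)
      have hk' : ∀ a ∈ F, (I.bipartiteBelow (fun i a => a ∈ S i) a).card = k := hcount
      rw [Finset.sum_congr rfl hk', Finset.sum_const, smul_eq_mul] at this
      rw [← this]
      refine Finset.sum_congr rfl fun i hi => ?_
      congr 1
      ext a
      simpa [Finset.mem_bipartiteAbove] using @hS i hi a
    have h3 : ∑ i ∈ I, ((S i).card : ℝ) = F.card * k := by exact_mod_cast h2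
    rw [Finset.sum_sub_distrib, ← Finset.sum_mul, h3]
    linarith
  obtain ⟨L, hL⟩ := hsh'.exists_tendsTo_of_nonneg
    (fun F g => by simp [hinv, Finset.card_mul_singleton]) (fun F => sub_nonneg.2 (hc F))
  refine ⟨L + c, fun ε hε => eventually_invariantFilter.1 ?_⟩
  filter_upwards [eventually_invariantFilter.2 (hL ε hε), eventually_nonempty] with F hF hne
  have hF0 : (F.card : ℝ) ≠ 0 := by exact_mod_cast hne.card_pos.ne'
  rw [sub_div, mul_div_cancel_left₀ _ hF0] at hF
  rwa [← sub_sub, sub_right_comm]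

/-! ### The partition function -/

/-- This is the form to which Finner's inequality applies; the reference configuration `x` is
immaterial. -/
theorem partitionFunction_eq_cylSum (φ : (G → ℕ) → ℝ) (F : Finset G) (x : G → ℕ) :
    partitionFunction φ F = cylSum F (supWeight φ F) x := by
  refine tsum_congr fun w => ?_
  rw [exp_iSup_birkhoff, supWeight, restrict_glue]

theorem birkhoff_eq_sum (φ : (G → ℕ) → ℝ) {F I : Finset G} {S : G → Finset G} {k : ℕ}
    (hS : ∀ i ∈ I, S i ⊆ F) (hcount : ∀ a ∈ F, (I.filter fun i => a ∈ S i).card = k)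
    (z : G → ℕ) : ∑ i ∈ I, birkhoff φ (S i) z = k * birkhoff φ F z := by
  have h1 : ∀ i ∈ I, birkhoff φ (S i) z = ∑ a ∈ F, if a ∈ S i then φ (shift a z) else 0 := by
    intro i hi
    rw [← Finset.sum_filter, Finset.filter_mem_eq_inter, Finset.inter_eq_right.2 (hS i hi)]
    rfl
  rw [Finset.sum_congr rfl h1, Finset.sum_comm, birkhoff, Finset.mul_sum]
  refine Finset.sum_congr rfl fun a ha => ?_
  rw [← Finset.sum_filter, Finset.sum_const, hcount a ha, nsmul_eq_mul]

/-- Shearer's inequality for the partition function. -/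
theorem partitionFunction_le_prod (φ : (G → ℕ) → ℝ) {F I : Finset G} {S : G → Finset G} {k : ℕ}
    (hk : 0 < k) (hS : ∀ i ∈ I, S i ⊆ F)
    (hcount : ∀ a ∈ F, (I.filter fun i => a ∈ S i).card = k) :
    partitionFunction φ F ≤ ∏ i ∈ I, partitionFunction φ (S i) ^ (k : ℝ)⁻¹ := by
  -- Pointwise, $e^{\phi_F}=\prod_i(e^{\phi_{S_i}})^{1/k}$, and the supremum of a product is at most
  -- the product of the suprema over the larger cylinders $[y_{S_i}]$.
  have hle : ∀ y, supWeight φ F y ≤ ∏ i ∈ I, supWeight φ (S i) y ^ (k : ℝ)⁻¹ := by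
    intro y
    refine iSup₂_le fun z hz => ?_
    rw [mem_cyl_restrict] at hz
    have hk' : (k : ℝ) ≠ 0 := by positivity
    have : ENNReal.ofReal (Real.exp (birkhoff φ F z)) =
        ∏ i ∈ I, ENNReal.ofReal (Real.exp (birkhoff φ (S i) z)) ^ (k : ℝ)⁻¹ := by
      rw [Finset.prod_congr rfl fun i _ => ENNReal.ofReal_rpow_of_pos (Real.exp_pos _),
        ← ENNReal.ofReal_prod_of_nonneg fun i _ => by positivity]
      congr 1
      rw [Finset.prod_congr rfl fun i _ => (Real.exp_mul _ _).symm, ← Real.exp_sum,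
        ← Finset.sum_mul, birkhoff_eq_sum φ hS hcount]
      field_simp
    rw [this]
    refine Finset.prod_le_prod' fun i hi => ?_
    gcongr
    exact le_supWeight φ _ fun g hg => hz g (hS i hi hg)
  rw [partitionFunction_eq_cylSum φ F 0]
  refine (ENNReal.tsum_le_tsum fun w => hle _).trans ?_
  refine (cylSum_prod_rpow_le F I S hk hcount _ (fun i => dependsOn_supWeight φ (S i)) 0).trans
    (le_of_eq (Finset.prod_congr rfl fun i hi => ?_))
  rw [Finset.inter_eq_right.2 (hS i hi), ← partitionFunction_eq_cylSum]

theorem birkhoff_mul_singleton (φ : (G → ℕ) → ℝ) (F : Finset G) (g : G) (x : G → ℕ) :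
    birkhoff φ (F * {g}) x = birkhoff φ F (shift g x) := by
  have : F * {g} = F.image (· * g) := Finset.image₂_singleton_right
  rw [birkhoff, this, Finset.sum_image fun a _ b _ h => mul_right_cancel h]
  simp [birkhoff, shift_shift]

theorem partitionFunction_mul_singleton (φ : (G → ℕ) → ℝ) (F : Finset G) (g : G) :
    partitionFunction φ (F * {g}) = partitionFunction φ F := by
  refine partitionFunction_eq_of_translate φ (g := g) (fun f hf => ?_) (fun f hf => ?_)
    fun x => (birkhoff_mul_singleton φ F g x).symm
  · exact Finset.mul_mem_mul hf (Finset.mem_singleton_self g)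
  · obtain ⟨a, ha, b, hb, rfl⟩ := Finset.mem_mul.1 hf
    rw [Finset.mem_singleton.1 hb]
    simpa using ha

/-- The zero configuration is fixed by every shift, so its single term already gives the linear
lower bound on $\log Z_F$ that the infimum rule needs. -/
theorem ofReal_exp_le_partitionFunction (φ : (G → ℕ) → ℝ) (F : Finset G) :
    ENNReal.ofReal (Real.exp (F.card * φ 0)) ≤ partitionFunction φ F := by
  have h0 : birkhoff φ F 0 = F.card * φ 0 := by
    have : ∀ g : G, shift g (0 : G → ℕ) = 0 := fun g => rfl
    simp [birkhoff, this]
  rw [partitionFunction_eq_cylSum φ F 0, ← h0]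
  refine le_trans ?_ (ENNReal.le_tsum (0 : F → ℕ))
  refine le_supWeight φ F fun g hg => ?_
  simp [glue]

theorem partitionFunction_ne_zero (φ : (G → ℕ) → ℝ) (F : Finset G) :
    partitionFunction φ F ≠ 0 :=
  ((ENNReal.ofReal_pos.2 (Real.exp_pos _)).trans_le (ofReal_exp_le_partitionFunction φ F)).ne'

theorem IsExpSummable.partitionFunction_ne_top {φ : (G → ℕ) → ℝ} (hexp : IsExpSummable φ)
    (F : Finset G) : partitionFunction φ F ≠ ∞ := by
  have h1 := partitionFunction_le_prod φ (F := F) (I := F) (S := fun a => {a}) one_pos (by simp)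
    (fun a ha => by
      rw [Finset.card_eq_one]
      exact ⟨a, by ext; simp; constructor <;> grind⟩)
  have h2 : ∀ a : G, partitionFunction φ {a} = partitionFunction φ {1} := fun a => by
    simpa using partitionFunction_mul_singleton φ {1} a
  refine ne_top_of_le_ne_top ?_ h1
  simpa [h2] using ENNReal.pow_ne_top (n := F.card) (ne_of_lt hexp)

theorem IsExpSummable.toReal_partitionFunction_pos {φ : (G → ℕ) → ℝ} (hexp : IsExpSummable φ)
    (F : Finset G) : 0 < (partitionFunction φ F).toReal :=
  ENNReal.toReal_pos (partitionFunction_ne_zero φ F) (hexp.partitionFunction_ne_top F)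

/-- The pressure of an exp-summable potential exists. -/
theorem IsExpSummable.hasPressure {φ : (G → ℕ) → ℝ} (hexp : IsExpSummable φ) :
    HasPressure φ (pressure φ) := by
  refine Classical.epsilon_spec (p := HasPressure φ) ?_
  refine SatisfiesShearer.exists_tendsTo (h := fun F => Real.log (partitionFunction φ F).toReal)
    ?_ (fun F g => by rw [partitionFunction_mul_singleton]) (c := φ 0) fun F => ?_
  · intro F I S k hk hS hcount
    have h1 := ENNReal.toReal_mono
      (ENNReal.prod_ne_top fun i _ => ENNReal.rpow_ne_top_of_nonneg (by positivity)
        (hexp.partitionFunction_ne_top (S i))) (partitionFunction_le_prod φ hk hS hcount)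
    have h2 := Real.log_le_log (hexp.toReal_partitionFunction_pos F) h1
    rw [ENNReal.toReal_prod, Real.log_prod fun i _ => by
      rw [← ENNReal.toReal_rpow]
      exact (Real.rpow_pos_of_pos (hexp.toReal_partitionFunction_pos _) _).ne'] at h2
    have h3 : ∀ i ∈ I, Real.log (partitionFunction φ (S i) ^ (k : ℝ)⁻¹).toReal =
        (k : ℝ)⁻¹ * Real.log (partitionFunction φ (S i)).toReal := fun i _ => by
      rw [← ENNReal.toReal_rpow, Real.log_rpow (hexp.toReal_partitionFunction_pos _)]
    rw [Finset.sum_congr rfl h3, ← Finset.mul_sum] at h2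
    have hk' : (0 : ℝ) < k := by exact_mod_cast hk
    calc (k : ℝ) * Real.log (partitionFunction φ F).toReal
        ≤ k * ((k : ℝ)⁻¹ * ∑ i ∈ I, Real.log (partitionFunction φ (S i)).toReal) := by gcongr
      _ = _ := by field_simp
  · rw [Real.le_log_iff_exp_le (hexp.toReal_partitionFunction_pos F)]
    exact (ENNReal.ofReal_le_iff_le_toReal (hexp.partitionFunction_ne_top F)).1
      (ofReal_exp_le_partitionFunction φ F)

/-! ### Variations -/

/-- Strict monotonicity of `E` makes every shell nonempty, so summability also bounds the variations
themselves and sends them to 0. -/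
theorem variation_le_term {E : ℕ → Finset G} (hE : IsExhaustion E) (φ : (G → ℕ) → ℝ) (m : ℕ) :
    variation φ (E (m + 1)) ≤
      ((((E (m + 2))⁻¹ * {1}) \ ((E (m + 1))⁻¹ * {1})).card : ℝ≥0∞) * variation φ (E (m + 1)) := by
  obtain ⟨g, hg, hg'⟩ := Finset.exists_of_ssubset (hE.strictMono (Nat.lt_succ_self (m + 1)))
  refine le_mul_of_one_le_left (zero_le) ?_
  have : 0 < (((E (m + 2))⁻¹ * {1}) \ ((E (m + 1))⁻¹ * {1})).card :=
    Finset.card_pos.2 ⟨g⁻¹, by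
      simp only [Finset.singleton_one, mul_one, Finset.mem_sdiff, Finset.mem_inv', inv_inv]
      exact ⟨hg, hg'⟩⟩
  exact_mod_cast this

theorem HasSummableVariation.variation_ne_top {E : ℕ → Finset G} (hE : IsExhaustion E)
    {φ : (G → ℕ) → ℝ} (hvar : HasSummableVariation E φ) (m : ℕ) :
    variation φ (E (m + 1)) ≠ ∞ :=
  ne_top_of_le_ne_top (ne_of_lt hvar) ((variation_le_term hE φ m).trans
    (ENNReal.le_tsum (f := fun m => ((((E (m + 2))⁻¹ * {1}) \ ((E (m + 1))⁻¹ * {1})).card : ℝ≥0∞) *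
      variation φ (E (m + 1))) m))

theorem HasSummableVariation.tendsto_variation {E : ℕ → Finset G} (hE : IsExhaustion E)
    {φ : (G → ℕ) → ℝ} (hvar : HasSummableVariation E φ) :
    Tendsto (fun m => variation φ (E (m + 1))) atTop (𝓝 0) :=
  tendsto_of_tendsto_of_tendsto_of_le_of_le tendsto_const_nhds
    (ENNReal.tendsto_atTop_zero_of_tsum_ne_top (ne_of_lt hvar)) (fun _ => zero_le)
    (variation_le_term hE φ)

theorem card_shell_le (K L F : Finset G) :
    ((K * F) \ (L * F)).card ≤ ((K * {1}) \ (L * {1})).card * F.card := by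
  have hsub : (K * F) \ (L * F) ⊆ (K \ L) * F := by
    intro g hg
    obtain ⟨hK, hL⟩ := Finset.mem_sdiff.1 hg
    obtain ⟨k, hk, f, hf, rfl⟩ := Finset.mem_mul.1 hK
    exact Finset.mul_mem_mul (Finset.mem_sdiff.2
      ⟨hk, fun h => hL (Finset.mul_mem_mul h hf)⟩) hf
  simpa only [Finset.singleton_one, mul_one] using
    (Finset.card_le_card hsub).trans Finset.card_mul_le

theorem HasSummableVariation.summable {E : ℕ → Finset G} {φ : (G → ℕ) → ℝ}
    (hvar : HasSummableVariation E φ) :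
    Summable fun m => ((((E (m + 2))⁻¹ * {1}) \ ((E (m + 1))⁻¹ * {1})).card : ℝ) *
      (variation φ (E (m + 1))).toReal := by
  simpa using ENNReal.summable_toReal (ne_of_lt hvar)

theorem HasSummableVariation.sumVariations_ne_top {E : ℕ → Finset G} {φ : (G → ℕ) → ℝ}
    (hvar : HasSummableVariation E φ) (F : Finset G) : sumVariations E φ F ≠ ∞ := by
  refine ne_top_of_le_ne_top (b := F.card * sumVariations E φ {1})
    (ENNReal.mul_ne_top (by simp) (ne_of_lt hvar)) ?_
  rw [sumVariations, sumVariations, ← ENNReal.tsum_mul_left]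
  refine ENNReal.tsum_le_tsum fun m => ?_
  rw [← mul_assoc]
  gcongr
  rw [mul_comm]
  exact_mod_cast card_shell_le _ _ F

/-- The sums of variations `V_F(φ)` are `o(|F|)`. -/
theorem HasSummableVariation.eventually_sumVariations_le {E : ℕ → Finset G}
    (hE : IsExhaustion E) {φ : (G → ℕ) → ℝ} (hvar : HasSummableVariation E φ) {ε : ℝ}
    (hε : 0 < ε) :
    ∀ᶠ F in invariantFilter G, (sumVariations E φ F).toReal ≤ ε * F.card := by
  have hlim : Tendsto (fun F : Finset G => ∑' m,
      ((((E (m + 2))⁻¹ * F) \ ((E (m + 1))⁻¹ * F)).card : ℝ) / F.card *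
        (variation φ (E (m + 1))).toReal) (invariantFilter G) (𝓝 (∑' _ : ℕ, (0 : ℝ))) := by
    -- Each shell of $F$ lies in $E_{m+2}^{-1}F\setminus F$, hence is $o(|F|)$; `card_shell_le`
    -- dominates the terms by those of $V_{\{1\}}(\phi)$.
    refine tendsto_tsum_of_dominated_convergence hvar.summable (fun m => ?_) ?_
    · rw [← zero_mul (variation φ (E (m + 1))).toReal]
      refine Tendsto.mul_const _ ?_
      rw [Metric.tendsto_nhds]
      intro η hη
      filter_upwards [eventually_card_sdiff_le (E (m + 2))⁻¹ (half_pos hη), eventually_nonempty]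
        with F hF hne
      have hF0 : (0 : ℝ) < F.card := by exact_mod_cast hne.card_pos
      rw [Real.dist_0_eq_abs, abs_of_nonneg (by positivity), div_lt_iff₀ hF0]
      have hsub : ((((E (m + 2))⁻¹ * F) \ ((E (m + 1))⁻¹ * F)).card : ℝ) ≤
          (((E (m + 2))⁻¹ * F) \ F).card := by
        refine Nat.cast_le.2 (Finset.card_le_card (Finset.sdiff_subset_sdiff subset_rfl ?_))
        exact Finset.subset_mul_right F (by simpa using hE.one_mem m)
      nlinarith
    · filter_upwards [eventually_nonempty] with F hne m
      have hF0 : (0 : ℝ) < F.card := by exact_mod_cast hne.card_pos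
      rw [Real.norm_of_nonneg (by positivity)]
      gcongr
      rw [div_le_iff₀ hF0]
      exact_mod_cast card_shell_le _ _ F
  rw [tsum_zero] at hlim
  filter_upwards [hlim.eventually (gt_mem_nhds hε), eventually_nonempty] with F hF hne
  have hF0 : (0 : ℝ) < F.card := by exact_mod_cast hne.card_pos
  have hsum : (sumVariations E φ F).toReal = ∑' m,
      ((((E (m + 2))⁻¹ * F) \ ((E (m + 1))⁻¹ * F)).card : ℝ) *
        (variation φ (E (m + 1))).toReal := by
    rw [sumVariations, ENNReal.tsum_toReal_eq fun m =>
      ENNReal.mul_ne_top (by simp) (hvar.variation_ne_top hE m)]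
    simp
  rw [hsum]
  have : (∑' m, ((((E (m + 2))⁻¹ * F) \ ((E (m + 1))⁻¹ * F)).card : ℝ) *
        (variation φ (E (m + 1))).toReal) = F.card * ∑' m,
      ((((E (m + 2))⁻¹ * F) \ ((E (m + 1))⁻¹ * F)).card : ℝ) / F.card *
        (variation φ (E (m + 1))).toReal := by
    rw [← tsum_mul_left]
    refine tsum_congr fun m => ?_
    field_simp
  rw [this, mul_comm]
  gcongr

/-- The contribution to a Birkhoff sum of the sites outside `F` varies by at most `V_F(φ)` when
a configuration is modified on `F`. -/
theorem sum_ofReal_abs_sub_le {E : ℕ → Finset G} (hE : IsExhaustion E) (φ : (G → ℕ) → ℝ)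
    {F A : Finset G} (hF : F.Nonempty) (hA : Disjoint A F) {x y : G → ℕ}
    (hxy : ∀ g, g ∉ F → x g = y g) :
    ∑ g ∈ A, ENNReal.ofReal |φ (shift g x) - φ (shift g y)| ≤ sumVariations E φ F := by
  have hpt : ∀ g ∈ A, ENNReal.ofReal |φ (shift g x) - φ (shift g y)| ≤
      ∑' m, if g ∈ ((E (m + 2))⁻¹ * F) \ ((E (m + 1))⁻¹ * F) then
        variation φ (E (m + 1)) else 0 := by
    intro g hg
    have hgF : g ∉ F := Finset.disjoint_left.1 hA hg
    have hex : ∃ n, g ∈ (E (n + 1))⁻¹ * F := by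
      obtain ⟨f, hf⟩ := hF
      obtain ⟨m, hm⟩ := hE.exhausts (f * g⁻¹)
      refine ⟨m, Finset.mem_mul.2 ⟨g * f⁻¹, ?_, f, hf, by group⟩⟩
      rw [Finset.mem_inv']
      simpa using hE.strictMono.monotone (Nat.le_succ m) hm
    classical
    -- The first `n` for which $E_{n+1}g$ meets $F$. It is not 0, because $E_1=\{1\}$ and $g\notin
    -- F$. With $n=m+1$, the shifted configurations agree on $E_{m+1}$.
    obtain ⟨n, hn, hmin⟩ : ∃ n, g ∈ (E (n + 1))⁻¹ * F ∧ ∀ k < n, g ∉ (E (k + 1))⁻¹ * F :=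
      ⟨Nat.find hex, Nat.find_spec hex, fun k hk => Nat.find_min hex hk⟩
    obtain _ | m := n
    · simp [hE.one, Finset.singleton_one, hgF] at hn
    refine le_trans ?_ (ENNReal.le_tsum m)
    have hm := hmin m (Nat.lt_succ_self m)
    rw [if_pos (Finset.mem_sdiff.2 ⟨hn, hm⟩)]
    refine le_variation φ fun e he => hxy _ fun hF => hm ?_
    exact Finset.mem_mul.2 ⟨e⁻¹, Finset.inv_mem_inv he, e * g, hF, by group⟩
  refine (Finset.sum_le_sum hpt).trans ?_
  rw [← Summable.tsum_finsetSum fun _ _ => ENNReal.summable]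
  refine ENNReal.tsum_le_tsum fun m => ?_
  rw [← Finset.sum_filter, Finset.sum_const, nsmul_eq_mul]
  gcongr
  exact fun g hg => (Finset.mem_filter.1 hg).2

/-- `φ_F` varies by `o(|F|)` on cylinder sets over `F`. -/
theorem HasSummableVariation.eventually_abs_birkhoff_sub_le {E : ℕ → Finset G}
    (hE : IsExhaustion E) {φ : (G → ℕ) → ℝ} (hvar : HasSummableVariation E φ) {ε : ℝ}
    (hε : 0 < ε) :
    ∀ᶠ F in invariantFilter G, ∀ x y : G → ℕ, (∀ g ∈ F, x g = y g) →
      |birkhoff φ F x - birkhoff φ F y| ≤ ε * F.card := by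
  set d : ℕ → ℝ := fun m => (variation φ (E (m + 1))).toReal with hd
  have hd0 : ∀ m, 0 ≤ d m := fun m => ENNReal.toReal_nonneg
  have hle : ∀ m (x y : G → ℕ), (∀ g ∈ E (m + 1), x g = y g) → |φ x - φ y| ≤ d m :=
    fun m x y h => (ENNReal.ofReal_le_iff_le_toReal (hvar.variation_ne_top hE m)).1
      (le_variation φ h)
  have hlim : Tendsto d atTop (𝓝 0) := by
    exact (ENNReal.tendsto_toReal ENNReal.zero_ne_top).comp (hvar.tendsto_variation hE)
  obtain ⟨m, hm⟩ := (hlim.eventually (gt_mem_nhds (half_pos hε))).exists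
  obtain ⟨η, hη, hηd⟩ : ∃ η : ℝ, 0 < η ∧ (E (m + 1)).card * η * d 0 ≤ ε / 2 := by
    have h1 : 0 ≤ (E (m + 1)).card * d 0 := mul_nonneg (by positivity) (hd0 0)
    refine ⟨ε / 2 / ((E (m + 1)).card * d 0 + 1), by positivity, ?_⟩
    calc (E (m + 1)).card * (ε / 2 / ((E (m + 1)).card * d 0 + 1)) * d 0
        = ε / 2 * (((E (m + 1)).card * d 0) / ((E (m + 1)).card * d 0 + 1)) := by field_simp
      _ ≤ ε / 2 * 1 := by
          gcongr
          rw [div_le_one (by linarith)]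
          linarith
      _ = ε / 2 := mul_one _
  filter_upwards [eventually_card_sdiff_le (E (m + 1)) hη] with F hF x y hxy
  -- Sites $g$ whose window $E_{m+1}g$ leaves $F$. They are few and cost at most `d 0` each, since
  -- $E_1=\{1\}$ only requires agreement at $g$; all other sites cost at most `d m`.
  set bad := F.filter fun g => ∃ e ∈ E (m + 1), e * g ∉ F with hbad
  have hcard : (bad.card : ℝ) ≤ (E (m + 1)).card * (η * F.card) := by
    have hsub : bad ⊆ (E (m + 1)).biUnion fun e => F.filter fun g => 1 * g ∈ F ∧ e * g ∉ F := by
      intro g hg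
      obtain ⟨hgF, e, he, heg⟩ := Finset.mem_filter.1 hg
      exact Finset.mem_biUnion.2 ⟨e, he, Finset.mem_filter.2 ⟨hgF, by simpa using hgF, heg⟩⟩
    have h1 : bad.card ≤ (E (m + 1)).card * ((E (m + 1) * F) \ F).card :=
      (Finset.card_le_card hsub).trans (Finset.card_biUnion_le_card_mul _ _ _ fun e he =>
        card_filter_mem_notMem_le F F _ (by simpa using he))
    calc (bad.card : ℝ) ≤ (E (m + 1)).card * ((E (m + 1) * F) \ F).card := by exact_mod_cast h1
      _ ≤ _ := by gcongr
  have hpt : ∀ g ∈ F, |φ (shift g x) - φ (shift g y)| ≤ d m + if g ∈ bad then d 0 else 0 := by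
    intro g hg
    by_cases hgb : g ∈ bad
    · rw [if_pos hgb]
      have : |φ (shift g x) - φ (shift g y)| ≤ d 0 := hle 0 _ _ fun e he => by
        rw [hE.one, Finset.mem_singleton] at he
        subst he
        simpa [shift] using hxy g hg
      linarith [hd0 m]
    · rw [if_neg hgb, add_zero]
      refine hle m _ _ fun e he => hxy _ ?_
      by_contra h
      exact hgb (Finset.mem_filter.2 ⟨hg, e, he, h⟩)
  have hfilter : F.filter (fun g => g ∈ bad) = bad := by
    rw [Finset.filter_mem_eq_inter]
    exact Finset.inter_eq_right.2 (Finset.filter_subset _ _)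
  calc |birkhoff φ F x - birkhoff φ F y|
      = |∑ g ∈ F, (φ (shift g x) - φ (shift g y))| := by
        rw [birkhoff, birkhoff, Finset.sum_sub_distrib]
    _ ≤ ∑ g ∈ F, |φ (shift g x) - φ (shift g y)| := Finset.abs_sum_le_sum_abs _ _
    _ ≤ ∑ g ∈ F, (d m + if g ∈ bad then d 0 else 0) := Finset.sum_le_sum hpt
    _ = F.card * d m + bad.card * d 0 := by
        rw [Finset.sum_add_distrib, ← Finset.sum_filter, hfilter]
        simp
    _ ≤ F.card * (ε / 2) + (E (m + 1)).card * (η * F.card) * d 0 := by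
        have := hd0 0
        gcongr
    _ = F.card * (ε / 2) + F.card * ((E (m + 1)).card * η * d 0) := by ring
    _ ≤ F.card * (ε / 2) + F.card * (ε / 2) := by gcongr
    _ = ε * F.card := by ring

/-! ### The Gibbsian specification on cylinder sets -/

theorem sum_abs_sub_le {E : ℕ → Finset G} (hE : IsExhaustion E) {φ : (G → ℕ) → ℝ}
    (hvar : HasSummableVariation E φ) {F A : Finset G} (hF : F.Nonempty) (hA : Disjoint A F)
    {x y : G → ℕ} (hxy : ∀ g, g ∉ F → x g = y g) :
    ∑ g ∈ A, |φ (shift g x) - φ (shift g y)| ≤ (sumVariations E φ F).toReal := by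
  rw [← ENNReal.ofReal_le_iff_le_toReal (hvar.sumVariations_ne_top F),
    ENNReal.ofReal_sum_of_nonneg fun _ _ => abs_nonneg _]
  exact sum_ofReal_abs_sub_le hE φ hF hA hxy

theorem summable_sub {E : ℕ → Finset G} (hE : IsExhaustion E) {φ : (G → ℕ) → ℝ}
    (hvar : HasSummableVariation E φ) {F : Finset G} (hF : F.Nonempty)
    {x y : G → ℕ} (hxy : ∀ g, g ∉ F → x g = y g) :
    Summable fun g => φ (shift g x) - φ (shift g y) := by
  refine Summable.of_abs (summable_of_sum_le (c := (sumVariations E φ F).toReal +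
    ∑ g ∈ F, |φ (shift g x) - φ (shift g y)|) (fun _ => abs_nonneg _) fun A => ?_)
  rw [← Finset.sum_inter_add_sum_sdiff A F, add_comm]
  gcongr
  · exact sum_abs_sub_le hE hvar hF Finset.sdiff_disjoint hxy
  · exact Finset.inter_subset_right

/-- Only the sites of $A\setminus F$ remain. The bound does not depend on $A$, so it survives the
limit along $A=E_m$. -/
theorem abs_birkhoff_sub_sub_le {E : ℕ → Finset G} (hE : IsExhaustion E) {φ : (G → ℕ) → ℝ}
    (hvar : HasSummableVariation E φ) {F A : Finset G} (hF : F.Nonempty) (hFA : F ⊆ A)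
    {x y : G → ℕ} (hxy : ∀ g, g ∉ F → x g = y g) :
    |(birkhoff φ A x - birkhoff φ A y) - (birkhoff φ F x - birkhoff φ F y)| ≤
      (sumVariations E φ F).toReal := by
  have h : (birkhoff φ A x - birkhoff φ A y) - (birkhoff φ F x - birkhoff φ F y) =
      ∑ g ∈ A \ F, (φ (shift g x) - φ (shift g y)) := by
    simp only [birkhoff, ← Finset.sum_sub_distrib]
    rw [sub_eq_iff_eq_add, Finset.sum_sdiff hFA]
  rw [h]
  exact (Finset.abs_sum_le_sum_abs _ _).trans
    (sum_abs_sub_le hE hvar hF Finset.sdiff_disjoint hxy)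

theorem IsExpSummable.supWeight_ne_top {φ : (G → ℕ) → ℝ} (hexp : IsExpSummable φ)
    (F : Finset G) (x : G → ℕ) (w : F → ℕ) : supWeight φ F (glue F w x) ≠ ∞ := by
  have := hexp.partitionFunction_ne_top F
  rw [partitionFunction_eq_cylSum φ F x] at this
  exact ENNReal.ne_top_of_tsum_ne_top this w

theorem IsExpSummable.hasSum_supWeight {φ : (G → ℕ) → ℝ} (hexp : IsExpSummable φ)
    (F : Finset G) (x : G → ℕ) :
    HasSum (fun w : F → ℕ => (supWeight φ F (glue F w x)).toReal)
      (partitionFunction φ F).toReal := by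
  have h := hexp.partitionFunction_ne_top F
  rw [partitionFunction_eq_cylSum φ F x] at h ⊢
  rw [cylSum, ENNReal.tsum_toReal_eq (ENNReal.ne_top_of_tsum_ne_top h)]
  exact ENNReal.hasSum_toReal h

/-- Only $v=w$ survives in the numerator. Dividing by it leaves differences of Birkhoff sums, which
converge by `summable_sub`. -/
theorem gibbsSpec_cyl_eq_limUnder (E : ℕ → Finset G) (φ : (G → ℕ) → ℝ) (F : Finset G)
    (w : F → ℕ) (x : G → ℕ) :
    gibbsSpec E φ F (cyl F w) x = limUnder atTop fun m : ℕ => (∑' v : F → ℕ,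
      Real.exp (birkhoff φ (E m) (glue F v x) - birkhoff φ (E m) (glue F w x)))⁻¹ := by
  unfold gibbsSpec
  congr 1
  ext m
  rw [tsum_eq_single w fun v hv => Set.indicator_of_notMem (by
      rwa [cyl, Set.mem_ofPred_eq, restrict_glue]) _,
    Set.indicator_of_mem (show glue F w x ∈ cyl F w from restrict_glue F w x)]
  simp only [Real.exp_sub]
  rw [tsum_div_const, inv_div]

/-- The specification of a cylinder set over `F` is comparable to `exp φ_F / Z_F`, with errors
controlled by the exterior variation `V_F(φ)` and the interior variation `D`. -/
theorem gibbsSpec_cyl_bounds {E : ℕ → Finset G} (hE : IsExhaustion E) {φ : (G → ℕ) → ℝ}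
    (hexp : IsExpSummable φ) (hvar : HasSummableVariation E φ) {F : Finset G} (hF : F.Nonempty)
    {D : ℝ} (hD : ∀ x y : G → ℕ, (∀ g ∈ F, x g = y g) →
      |birkhoff φ F x - birkhoff φ F y| ≤ D) (x y : G → ℕ) :
    Real.exp (birkhoff φ F y - ((sumVariations E φ F).toReal + 2 * D)) /
        (partitionFunction φ F).toReal ≤ gibbsSpec E φ F (cyl F (F.restrict y)) x ∧
      gibbsSpec E φ F (cyl F (F.restrict y)) x ≤
        Real.exp (birkhoff φ F y + ((sumVariations E φ F).toReal + 2 * D)) /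
          (partitionFunction φ F).toReal := by
  set V := (sumVariations E φ F).toReal with hV
  set Z := (partitionFunction φ F).toReal with hZ
  set w := F.restrict y with hw
  set a : (F → ℕ) → ℝ := fun v => (supWeight φ F (glue F v x)).toReal with ha
  set q : ℕ → (F → ℕ) → ℝ := fun m v =>
    Real.exp (birkhoff φ (E m) (glue F v x) - birkhoff φ (E m) (glue F w x)) with hq
  set b := birkhoff φ F y
  have hZ0 : 0 < Z := hexp.toReal_partitionFunction_pos F
  have hD0 : 0 ≤ D := (abs_nonneg _).trans (hD x x fun _ _ => rfl)
  have hoff : ∀ v g, g ∉ F → glue F v x g = glue F w x g := fun v g hg => by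
    rw [glue_of_notMem v x hg, glue_of_notMem w x hg]
  have hsum : HasSum a Z := hexp.hasSum_supWeight F x
  have hb : |birkhoff φ F (glue F w x) - b| ≤ D := hD _ _ fun g hg => by
    rw [glue_of_mem w x hg]
    rfl
  have hle_a : ∀ v, Real.exp (birkhoff φ F (glue F v x)) ≤ a v := fun v =>
    (ENNReal.ofReal_le_iff_le_toReal (hexp.supWeight_ne_top F x v)).1
      (le_supWeight φ F fun _ _ => rfl)
  have ha_le : ∀ v, a v ≤ Real.exp (birkhoff φ F (glue F v x) + D) := fun v => by
    refine ENNReal.toReal_le_of_le_ofReal (Real.exp_pos _).le (iSup₂_le fun z hz => ?_)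
    have := (abs_le.1 (hD _ _ (mem_cyl_restrict.1 hz))).2
    gcongr
    linarith
  have hev : ∀ᶠ m in atTop, F ⊆ E m := hE.tendsto_atTop.eventually (eventually_ge_atTop F)
  -- Replacing $\phi_{E_m}$ by $\phi_F$ costs `V`, and replacing $w\,x_{F^c}$ by $y$ costs `D`. In
  -- `hlower`, passing from a value to the supremum over its cylinder costs another `D`.
  have hupper : ∀ m, F ⊆ E m → ∀ v, q m v ≤ Real.exp (V + D - b) * a v := fun m hm v => by
    have h1 := (abs_le.1 (abs_birkhoff_sub_sub_le hE hvar hF hm (hoff v))).2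
    have h2 := (abs_le.1 hb).1
    calc q m v ≤ Real.exp (V + D - b) * Real.exp (birkhoff φ F (glue F v x)) := by
          rw [← Real.exp_add]
          refine Real.exp_le_exp.2 ?_
          linarith
      _ ≤ _ := by
          gcongr
          exact hle_a v
  have hlower : ∀ m, F ⊆ E m → ∀ v, Real.exp (-(V + 2 * D) - b) * a v ≤ q m v := fun m hm v => by
    have h1 := (abs_le.1 (abs_birkhoff_sub_sub_le hE hvar hF hm (hoff v))).1
    have h2 := (abs_le.1 hb).2
    calc _ ≤ Real.exp (-(V + 2 * D) - b) * Real.exp (birkhoff φ F (glue F v x) + D) := by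
          gcongr
          exact ha_le v
      _ ≤ _ := by
          rw [← Real.exp_add]
          refine Real.exp_le_exp.2 ?_
          linarith
  -- The limit must be shown to exist, as `limUnder` is meaningless otherwise; the weights `a`, of
  -- sum `Z`, dominate.
  have hlim : Tendsto (fun m => ∑' v, q m v) atTop (𝓝 (∑' v : F → ℕ,
      Real.exp (∑' g, (φ (shift g (glue F v x)) - φ (shift g (glue F w x)))))) := by
    refine tendsto_tsum_of_dominated_convergence (hsum.summable.mul_left (Real.exp (V + D - b)))
      (fun v => ?_) (hev.mono fun m hm v => ?_)
    · refine (Real.continuous_exp.tendsto _).comp ?_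
      simp only [birkhoff, ← Finset.sum_sub_distrib]
      exact (summable_sub hE hvar hF (hoff v)).hasSum.comp hE.tendsto_atTop
    · rw [Real.norm_of_nonneg (Real.exp_pos _).le]
      exact hupper m hm v
  set Q := ∑' v : F → ℕ, Real.exp (∑' g, (φ (shift g (glue F v x)) - φ (shift g (glue F w x))))
  have hqs : ∀ m, F ⊆ E m → Summable (q m) := fun m hm =>
    Summable.of_nonneg_of_le (fun v => (Real.exp_pos _).le) (hupper m hm)
      (hsum.summable.mul_left _)
  have hQ1 : Q ≤ Real.exp (V + D - b) * Z := by
    refine le_of_tendsto hlim (hev.mono fun m hm => ?_)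
    exact hasSum_le (hupper m hm) (hqs m hm).hasSum (hsum.mul_left _)
  have hQ2 : Real.exp (-(V + 2 * D) - b) * Z ≤ Q := by
    refine ge_of_tendsto hlim (hev.mono fun m hm => ?_)
    exact hasSum_le (hlower m hm) (hsum.mul_left _) (hqs m hm).hasSum
  have hQ0 : 0 < Q := lt_of_lt_of_le (by positivity) hQ2
  rw [gibbsSpec_cyl_eq_limUnder, (hlim.inv₀ hQ0.ne').limUnder_eq]
  constructor
  · rw [div_le_iff₀ hZ0, ← div_eq_inv_mul, le_div_iff₀ hQ0]
    calc Real.exp (b - (V + 2 * D)) * Q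
        ≤ Real.exp (b - (V + 2 * D)) * (Real.exp (V + D - b) * Z) := by gcongr
      _ = Real.exp (-D) * Z := by rw [← mul_assoc, ← Real.exp_add]; ring_nf
      _ ≤ 1 * Z := by
          gcongr
          exact Real.exp_le_one_iff.2 (by linarith)
      _ = Z := one_mul Z
  · rw [le_div_iff₀ hZ0, ← div_eq_inv_mul, div_le_iff₀ hQ0]
    calc Z = Real.exp (b + (V + 2 * D)) * (Real.exp (-(V + 2 * D) - b) * Z) := by
          rw [← mul_assoc, ← Real.exp_add,
            show b + (V + 2 * D) + (-(V + 2 * D) - b) = 0 by ring, Real.exp_zero, one_mul]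
      _ ≤ _ := by gcongr

/-- Asymptotically in `F`, the specification of cylinder sets over `F` is `exp (φ_F - p |F|)`, up
to subexponential errors. -/
theorem eventually_gibbsSpec_cyl_bounds {E : ℕ → Finset G} (hE : IsExhaustion E)
    {φ : (G → ℕ) → ℝ} (hexp : IsExpSummable φ) (hvar : HasSummableVariation E φ) {p : ℝ}
    (hp : HasPressure φ p) {ε : ℝ} (hε : 0 < ε) :
    ∀ᶠ F in invariantFilter G, ∀ x y : G → ℕ,
      Real.exp (-ε * F.card) ≤ gibbsSpec E φ F (cyl F (F.restrict y)) x /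
          Real.exp (birkhoff φ F y - p * F.card) ∧
        gibbsSpec E φ F (cyl F (F.restrict y)) x / Real.exp (birkhoff φ F y - p * F.card) ≤
          Real.exp (ε * F.card) := by
  -- Error budget: $V_F+2D\le(\epsilon/4+2\epsilon/8)|F|=(\epsilon/2)|F|$, and the pressure takes
  -- the other $\epsilon/2$.
  filter_upwards [eventually_nonempty,
    hvar.eventually_sumVariations_le hE (show 0 < ε / 4 by positivity),
    hvar.eventually_abs_birkhoff_sub_le hE (show 0 < ε / 8 by positivity),
    eventually_invariantFilter.2 (hp (ε / 2) (by positivity))] with F hF hV hD hP x y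
  have hF0 : (0 : ℝ) < F.card := by exact_mod_cast hF.card_pos
  obtain ⟨h1, h2⟩ := gibbsSpec_cyl_bounds hE hexp hvar hF hD x y
  have hZ0 := hexp.toReal_partitionFunction_pos F
  obtain ⟨h3, h4⟩ := abs_lt.1 hP
  rw [lt_sub_iff_add_lt, lt_div_iff₀ hF0] at h3
  rw [sub_lt_iff_lt_add, div_lt_iff₀ hF0] at h4
  rw [← Real.exp_log hZ0, ← Real.exp_sub] at h1 h2
  constructor
  · rw [le_div_iff₀ (Real.exp_pos _), ← Real.exp_add]
    refine le_trans ?_ h1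
    gcongr
    linarith
  · rw [div_le_iff₀ (Real.exp_pos _), ← Real.exp_add]
    refine h2.trans ?_
    gcongr
    linarith

/-! ### DLR measures -/

/-- As $X_F$ is countable, one null set serves all $w$, hence all $y$ in the theorem. -/
theorem IsDLR.ae_condExp_cyl_eq {E : ℕ → Finset G} {φ : (G → ℕ) → ℝ} {μ : Measure (G → ℕ)}
    (hμ : IsDLR E φ μ) {F : Finset G} (hF : F.Nonempty) :
    ∀ᵐ x ∂μ, ∀ w : F → ℕ, (μ⟦cyl F w | outside F⟧) x = gibbsSpec E φ F (cyl F w) x :=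
  ae_all_iff.2 fun w => hμ F hF (cyl F w) (measurableSet_cyl F w)

theorem measureReal_bounds_of_condExp {Ω : Type*} {m m₀ : MeasurableSpace Ω} (hm : m ≤ m₀)
    {μ : Measure Ω} [IsProbabilityMeasure μ] {B : Set Ω} (hB : MeasurableSet B) {c a b : ℝ}
    (h : ∀ᵐ x ∂μ, a ≤ (μ⟦B | m⟧) x / c ∧ (μ⟦B | m⟧) x / c ≤ b) :
    a ≤ μ.real B / c ∧ μ.real B / c ≤ b := by
  have hint : Integrable (fun x => (μ⟦B | m⟧) x / c) μ := integrable_condExp.div_const c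
  have heq : ∫ x, (μ⟦B | m⟧) x / c ∂μ = μ.real B / c := by
    rw [integral_div, integral_condExp hm, integral_indicator_const _ hB]
    simp
  rw [← heq]
  constructor
  · simpa using integral_mono_ae (integrable_const a) hint (h.mono fun x hx => hx.1)
  · simpa using integral_mono_ae hint (integrable_const b) (h.mono fun x hx => hx.2)

end GibbsFullShift

end

/-! ### Gibbs bounds, conditional and unconditional -/

theorem mainTheorem4 {G : Type*} [Group G] [Countable G] [DecidableEq G]
    (hG : GibbsFullShift.IsAmenable G)
    (E : ℕ → Finset G) (hE : GibbsFullShift.IsExhaustion E)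
    (φ : (G → ℕ) → ℝ)
    (hexp : GibbsFullShift.IsExpSummable φ)
    (hvar : GibbsFullShift.HasSummableVariation E φ)
    (μ : MeasureTheory.Measure (G → ℕ)) [MeasureTheory.IsProbabilityMeasure μ]
    (hμ : GibbsFullShift.IsDLR E φ μ) :
    GibbsFullShift.HasPressure φ (GibbsFullShift.pressure φ) ∧
    (∀ ε : ℝ, 0 < ε → ∃ K : Finset G, K.Nonempty ∧ ∃ δ : ℝ, 0 < δ ∧
      ∀ F : Finset G, F.Nonempty → GibbsFullShift.IsInvariant K δ F →
        ∀ᵐ x ∂μ, ∀ y : G → ℕ,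
          Real.exp (-ε * F.card) ≤
            (μ⟦GibbsFullShift.cyl F (F.restrict y) | GibbsFullShift.outside F⟧) x /
              Real.exp (GibbsFullShift.birkhoff φ F y - GibbsFullShift.pressure φ * F.card) ∧
          (μ⟦GibbsFullShift.cyl F (F.restrict y) | GibbsFullShift.outside F⟧) x /
              Real.exp (GibbsFullShift.birkhoff φ F y - GibbsFullShift.pressure φ * F.card) ≤
            Real.exp (ε * F.card)) ∧
    GibbsFullShift.IsBowenGibbsWith φ (GibbsFullShift.pressure φ) μ := by
  have hp := hexp.hasPressure
  have hcond : ∀ ε : ℝ, 0 < ε → ∀ᶠ F in GibbsFullShift.invariantFilter G, ∀ᵐ x ∂μ, ∀ y : G → ℕ,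
      Real.exp (-ε * F.card) ≤
          (μ⟦GibbsFullShift.cyl F (F.restrict y) | GibbsFullShift.outside F⟧) x /
            Real.exp (GibbsFullShift.birkhoff φ F y - GibbsFullShift.pressure φ * F.card) ∧
        (μ⟦GibbsFullShift.cyl F (F.restrict y) | GibbsFullShift.outside F⟧) x /
            Real.exp (GibbsFullShift.birkhoff φ F y - GibbsFullShift.pressure φ * F.card) ≤
          Real.exp (ε * F.card) := by
    intro ε hε
    filter_upwards [GibbsFullShift.eventually_nonempty,
      GibbsFullShift.eventually_gibbsSpec_cyl_bounds hE hexp hvar hp hε] with F hF hbound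
    filter_upwards [hμ.ae_condExp_cyl_eq hF] with x hx y
    rw [hx]
    exact hbound x y
  refine ⟨hp, fun ε hε => GibbsFullShift.eventually_invariantFilter.1 (hcond ε hε),
    fun ε hε => GibbsFullShift.eventually_invariantFilter.1 ?_⟩
  filter_upwards [hcond ε hε] with F hF y
  exact GibbsFullShift.measureReal_bounds_of_condExp
    (MeasureTheory.cylinderEvents_le_pi (X := fun _ : G => ℕ))
    (GibbsFullShift.measurableSet_cyl F _) (hF.mono fun x hx => hx y)
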